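/- Let $(M,d)$ be a compact metric space and let $\mu$ be a Borel probability measure on $M$ whose support is all of $M$. Let $\Omega=M^{\mathbb N}$ be the space of sequences $x=(x_1,x_2,\ldots)$ in $M$ with the metric $d_\Omega(x,y)=\sum_{n\ge 1}2^{-n}d(x_n,y_n)$, let $\sigma(x_1,x_2,\ldots)=(x_2,x_3,\ldots)$ be the left shift, and for $0<\alpha<1$ let $C^\alpha(\Omega)$ be the set of functions $g:\Omega\to\mathbb R$ that are $\alpha$-Hölder continuous with respect to $d_\Omega$. For $f\in C^\alpha(\Omega)$ let $\mathscr L_f$ be the Ruelle operator $$\mathscr L_f(\varphi)(x)=\int_M e^{f(ax)}\varphi(ax)\,d\mu(a),\qquad ax=(a,x_1,x_2,\ldots),\quad \varphi\in C(\Omega).$$ There is exactly one triple $(\lambda_f,h_f,\nu_f)$ consisting of a number $\lambda_f>0$, a strictly positive function $h_f\in C^\alpha(\Omega)$ and a Borel probability measure $\nu_f$ on $\Omega$ such that $\mathscr L_f h_f=\lambda_f h_f$, $\mathscr L_f^*\nu_f=\lambda_f\nu_f$ (that is, $\int\mathscr L_f\varphi\,d\nu_f=\lambda_f\int\varphi\,d\nu_f$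 for all $\varphi\in C(\Omega)$) and $\int h_f\,d\nu_f=1$. Let $m_f=h_f\nu_f$. Then for all $\varphi,\psi\in C^\alpha(\Omega)$ there exist constants $K>0$ and $0<\tau<1$ such that for all integers $n\ge 0$ $$\left|\int(\varphi\circ\sigma^n)\,\psi\,dm_f-\int\varphi\,dm_f\int\psi\,dm_f\right|\le K\tau^n .$$ -/

import Mathlib

open MeasureTheory

noncomputable section

namespace RuelleShift

/-- The left shift `σ (x₁, x₂, …) = (x₂, x₃, …)` on `Ω = M^ℕ`; sequences are indexed from `0`. -/
def shift {M : Type*} (x : ℕ → M) : ℕ → M := fun n => x (n + 1)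

/-- The sequence `ax = (a, x₁, x₂, …)`. -/
def cons {M : Type*} (a : M) (x : ℕ → M) : ℕ → M
  | 0 => a
  | n + 1 => x n

/-- The metric `d_Ω (x, y) = ∑_{n ≥ 1} 2⁻ⁿ d(xₙ, yₙ)` on `Ω`; the series converges because
the metric of a compact space is bounded. It induces the product topology. -/
def seqDist {M : Type*} [MetricSpace M] (x y : ℕ → M) : ℝ :=
  ∑' n : ℕ, (1 / 2 : ℝ) ^ (n + 1) * dist (x n) (y n)

/-- `g ∈ C^α(Ω)`: the function `g` is `α`-Hölder continuous with respect to `d_Ω`. -/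
def IsHolder {M : Type*} [MetricSpace M] (α : ℝ) (g : (ℕ → M) → ℝ) : Prop :=
  ∃ C : ℝ, ∀ x y : ℕ → M, |g x - g y| ≤ C * seqDist x y ^ α

/-- The Ruelle operator `(L_f φ)(x) = ∫_M e^{f(ax)} φ(ax) dμ(a)` with a priori measure `μ`. -/
def ruelleOp {M : Type*} [MeasurableSpace M] (μ : Measure M) (f φ : (ℕ → M) → ℝ) :
    (ℕ → M) → ℝ :=
  fun x => ∫ a, Real.exp (f (cons a x)) * φ (cons a x) ∂μ

/-- `(lam, h, ν)` is the maximal eigendata of `L_f`, normalized by `∫ h dν = 1`: a positive number,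
a strictly positive function in `C^α(Ω)` and a Borel probability measure on `Ω` with
`L_f h = lam h` and `L_f^* ν = lam ν`. -/
structure IsEigendata {M : Type*} [MetricSpace M] [MeasurableSpace M] (α : ℝ) (μ : Measure M)
    (f : (ℕ → M) → ℝ) (lam : ℝ) (h : (ℕ → M) → ℝ) (ν : Measure (ℕ → M)) : Prop where
  lam_pos : 0 < lam
  holder : IsHolder α h
  h_pos : ∀ x, 0 < h x
  eigenfunction : ∀ x, ruelleOp μ f h x = lam * h x
  prob : IsProbabilityMeasure ν
  eigenmeasure : ∀ φ : (ℕ → M) → ℝ, Continuous φ → ∫ x, ruelleOp μ f φ x ∂ν = lam * ∫ x, φ x ∂ν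
  normalized : ∫ x, h x ∂ν = 1

/-- The measure `m = h ν`, that is `dm = h dν`. -/
def eqMeasure {M : Type*} [MeasurableSpace M] (h : (ℕ → M) → ℝ) (ν : Measure (ℕ → M)) :
    Measure (ℕ → M) :=
  ν.withDensity fun x => ENNReal.ofReal (h x)

/-- The correlation function `C_{φ,ψ,m}(n) = ∫ (φ ∘ σⁿ) ψ dm - ∫ φ dm ∫ ψ dm`. -/
def correlation {M : Type*} [MeasurableSpace M] (m : Measure (ℕ → M)) (φ ψ : (ℕ → M) → ℝ)
    (n : ℕ) : ℝ :=
  ∫ x, φ (shift^[n] x) * ψ x ∂m - (∫ x, φ x ∂m) * ∫ x, ψ x ∂m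

end RuelleShift

end

open Filter Topology MeasureTheory

namespace RuelleShift

/-! With `ρ = d_Ω ^ α`, Hölder functions are the `ρ`-Lipschitz ones. Prepending a common symbol
halves `d_Ω`, so the Ruelle operator `L` maps positive functions with log-Lipschitz constant `B` to
ones with constant `θ * B + C`, where `θ = 2 ^ (-α) < 1` (`isLogContraction_ruelleMap`). Hence all
`L ^ n 1` share the constant `A = C / (1 - θ)`.

The normalized step `ψ ↦ L (L ^ n 1 * ψ) / L ^ (n + 1) 1` fixes constants and strictly improves a
large log-Lipschitz constant. The improvement pays for removing a fixed proportion of the function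
as a constant while staying in the cone (`exists_split`). Iterating, `L ^ n φ / L ^ n 1` tends
geometrically to a constant `Λ φ`. Density of Hölder functions extends `Λ` to all continuous
functions; it is positive and dual to `L`. Setting `lam = Λ (L 1)`, the functions `lam⁻ⁿ L ^ n 1`
converge to the eigenfunction `h`, and Riesz representation turns `Λ` into `ν`.

Convergence of `lam⁻ⁿ L ^ n φ` to `Λ φ • h` forces uniqueness of the triple. Since `L ^ n ((φ ∘ σ ^
n) * ψ) = φ * L ^ n ψ`, applied with `ψ * h` it also gives decay of correlations. -/

/-- `φ` is strictly positive and `log φ` is `B`-Lipschitz with respect to `ρ`. -/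
def LogLip {X : Type*} [TopologicalSpace X] (ρ : X → X → ℝ) (B : ℝ) (φ : C(X, ℝ)) : Prop :=
  (∀ x, 0 < φ x) ∧ ∀ x y, φ x ≤ Real.exp (B * ρ x y) * φ y

/-- `φ` is Lipschitz with respect to `ρ`. -/
def Lip {X : Type*} [TopologicalSpace X] (ρ : X → X → ℝ) (φ : C(X, ℝ)) : Prop :=
  ∃ c : ℝ, ∀ x y, |φ x - φ y| ≤ c * ρ x y

/-- A positive operator on continuous functions that contracts the logarithmic Lipschitz constant
up to an additive error. -/
structure IsLogContraction {X : Type*} [TopologicalSpace X] (ρ : X → X → ℝ) (D θ C : ℝ)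
    (L : C(X, ℝ) →ₗ[ℝ] C(X, ℝ)) : Prop where
  gauge_nonneg : ∀ x y, 0 ≤ ρ x y
  gauge_symm : ∀ x y, ρ x y = ρ y x
  gauge_le : ∀ x y, ρ x y ≤ D
  rate_nonneg : 0 ≤ θ
  rate_lt_one : θ < 1
  error_nonneg : 0 ≤ C
  map_nonneg : ∀ φ : C(X, ℝ), 0 ≤ φ → 0 ≤ L φ
  map_logLip : ∀ B φ, 0 ≤ B → LogLip ρ B φ → LogLip ρ (θ * B + C) (L φ)

/-! ### The cone of log-Lipschitz functions -/

section Cone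

variable {X : Type*} [TopologicalSpace X] {ρ : X → X → ℝ} {D : ℝ}

theorem LogLip.mono (hρ : ∀ x y, 0 ≤ ρ x y) {B B' : ℝ} (h : B ≤ B') {φ : C(X, ℝ)}
    (hφ : LogLip ρ B φ) : LogLip ρ B' φ := by
  refine ⟨hφ.1, fun x y => (hφ.2 x y).trans ?_⟩
  have := hφ.1 y
  have := hρ x y
  gcongr

theorem LogLip.one : LogLip ρ 0 (1 : C(X, ℝ)) := by
  constructor <;> simp

theorem LogLip.mul {A B : ℝ} {φ ψ : C(X, ℝ)} (hφ : LogLip ρ A φ) (hψ : LogLip ρ B ψ) :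
    LogLip ρ (A + B) (φ * ψ) := by
  refine ⟨fun x => mul_pos (hφ.1 x) (hψ.1 x), fun x y => ?_⟩
  have h := mul_le_mul (hφ.2 x y) (hψ.2 x y) (hψ.1 x).le
    (mul_nonneg (Real.exp_pos _).le (hφ.1 y).le)
  rw [add_mul, Real.exp_add]
  simp only [ContinuousMap.mul_apply]
  linarith

/-- The multiplicative inverse of a nowhere vanishing continuous function. -/
noncomputable def recip (φ : C(X, ℝ)) (h : ∀ x, 0 < φ x) : C(X, ℝ) :=
  ⟨fun x => (φ x)⁻¹, φ.continuous.inv₀ fun x => (h x).ne'⟩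

theorem LogLip.recip (hs : ∀ x y, ρ x y = ρ y x) {A : ℝ} {φ : C(X, ℝ)} (hφ : LogLip ρ A φ) :
    LogLip ρ A (recip φ hφ.1) := by
  refine ⟨fun x => inv_pos.2 (hφ.1 x), fun x y => ?_⟩
  have h := hφ.2 y x
  have hx := hφ.1 x
  have hy := hφ.1 y
  simp only [RuelleShift.recip, ContinuousMap.coe_mk]
  rw [hs y x] at h
  rw [← div_eq_mul_inv, inv_eq_one_div, div_le_div_iff₀ hx hy]
  linarith

/-- A small constant may be subtracted from a function at the cost of a larger logarithmic
Lipschitz constant. -/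
theorem LogLip.sub_const (hρ : ∀ x y, 0 ≤ ρ x y) (hD : ∀ x y, ρ x y ≤ D) {B B' : ℝ}
    (hB' : 0 ≤ B') (hB : B' < B) {ψ : C(X, ℝ)} (hψ : LogLip ρ B' ψ) {c : ℝ}
    (hc : ∀ x, c ≤ (B - B') / (B * Real.exp (B * D)) / 2 * ψ x) :
    LogLip ρ B (ψ - ContinuousMap.const X c) := by
  have hBpos : 0 < B := hB'.trans_lt hB
  refine ⟨fun x => ?_, fun x y => ?_⟩
  · have hx := hψ.1 x
    have hD0 : 0 ≤ D := (hρ x x).trans (hD x x)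
    -- The subtracted constant is at most half of `ψ x`, so positivity survives.
    have h1 : (B - B') / (B * Real.exp (B * D)) ≤ 1 := by
      rw [div_le_one (by positivity)]
      have : 1 ≤ Real.exp (B * D) := Real.one_le_exp (by positivity)
      nlinarith
    have := hc x
    simp only [ContinuousMap.sub_apply, ContinuousMap.const_apply]
    nlinarith
  · set r := ρ x y
    have hr : 0 ≤ r := hρ x y
    have hy := hψ.1 y
    have hxy := hψ.2 x y
    -- The claim rearranges to `c * (exp (B r) - 1) ≤ exp (B r) * ψ y - ψ x`. It suffices that `δ *
    -- (exp (B r) - 1) ≤ exp (B r) - exp (B' r)` for `0 ≤ r ≤ D`; both sides are compared with the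
    -- linear function `(B - B') * r`.
    set δ := (B - B') / (B * Real.exp (B * D)) with hδ
    have hδ0 : 0 ≤ δ := div_nonneg (by linarith) (by positivity)
    have e0 : δ * (B * Real.exp (B * D)) = B - B' := by rw [hδ]; field_simp
    have e1 : Real.exp (B * r) - 1 ≤ B * r * Real.exp (B * D) := by
      have h1 : 1 - B * r ≤ Real.exp (-(B * r)) := by
        have := Real.add_one_le_exp (-(B * r)); linarith
      have h2 : Real.exp (-(B * r)) * Real.exp (B * r) = 1 := by
        rw [← Real.exp_add]; simp
      have h3 : Real.exp (B * r) ≤ Real.exp (B * D) := by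
        have := hD x y
        gcongr
      have h4 : 0 ≤ B * r := by positivity
      have h5 := Real.exp_pos (B * r)
      nlinarith
    have e2 : (B - B') * r ≤ Real.exp (B * r) - Real.exp (B' * r) := by
      have h1 : Real.exp (B * r) = Real.exp (B' * r) * Real.exp ((B - B') * r) := by
        rw [← Real.exp_add]; ring_nf
      have h2 := Real.add_one_le_exp ((B - B') * r)
      have h3 : 1 ≤ Real.exp (B' * r) := Real.one_le_exp (by positivity)
      have h4 : 0 ≤ (B - B') * r := mul_nonneg (by linarith) hr
      rw [h1]; nlinarith
    have e3 : δ * (Real.exp (B * r) - 1) ≤ Real.exp (B * r) - Real.exp (B' * r) := by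
      calc _ ≤ δ * (B * r * Real.exp (B * D)) := by gcongr
        _ = (B - B') * r := by rw [← e0]; ring
        _ ≤ _ := e2
    have e4 : 0 ≤ Real.exp (B * r) - 1 := by
      have : 1 ≤ Real.exp (B * r) := Real.one_le_exp (by positivity)
      linarith
    have e5 : c ≤ δ * ψ y := (hc y).trans (by nlinarith [mul_nonneg hδ0 hy.le])
    simp only [ContinuousMap.sub_apply, ContinuousMap.const_apply]
    nlinarith [mul_le_mul_of_nonneg_right e5 e4, mul_le_mul_of_nonneg_left e3 hy.le]

/-- Since `φ y ≥ exp (-A ρ) * φ x` and `1 - exp (-t) ≤ t`, differences are at most `A ρ ‖φ‖`; the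
factor `exp (A D) ≥ 1` is slack. This makes `L 1` eligible for geometric rates and the eigenfunction
Hölder. -/
theorem LogLip.lip [CompactSpace X] (hρ : ∀ x y, 0 ≤ ρ x y) (hs : ∀ x y, ρ x y = ρ y x)
    (hD : ∀ x y, ρ x y ≤ D) {A : ℝ} (hA : 0 ≤ A) {φ : C(X, ℝ)} (hφ : LogLip ρ A φ) :
    Lip ρ φ := by
  have key : ∀ x y, φ x - φ y ≤ A * Real.exp (A * D) * ‖φ‖ * ρ x y := by
    intro x y
    have h1 : 1 - A * ρ x y ≤ Real.exp (-(A * ρ x y)) := by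
      have := Real.add_one_le_exp (-(A * ρ x y)); linarith
    have h2 : Real.exp (-(A * ρ x y)) * φ x ≤ φ y := by
      have := hφ.2 x y
      rw [Real.exp_neg, inv_mul_le_iff₀ (Real.exp_pos _)]
      exact this
    have h3 : φ x ≤ ‖φ‖ := (le_abs_self _).trans (φ.norm_coe_le_norm x)
    have h4 : 0 ≤ A * ρ x y := mul_nonneg hA (hρ x y)
    have hx := hφ.1 x
    have h5 : 1 ≤ Real.exp (A * D) :=
      Real.one_le_exp (mul_nonneg hA ((hρ x y).trans (hD x y)))
    calc φ x - φ y ≤ A * ρ x y * φ x := by nlinarith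
      _ ≤ A * ρ x y * ‖φ‖ := by gcongr
      _ ≤ A * ρ x y * ‖φ‖ * Real.exp (A * D) :=
        le_mul_of_one_le_right (by positivity) h5
      _ = _ := by ring
  refine ⟨_, fun x y => abs_sub_le_iff.2 ⟨key x y, ?_⟩⟩
  rw [hs x y]
  exact key y x

/-- A Lipschitz function enters the cone after adding a large constant. -/
theorem Lip.exists_logLip_add_const [CompactSpace X] (hρ : ∀ x y, 0 ≤ ρ x y) {B : ℝ} (hB : 0 < B)
    {φ : C(X, ℝ)} (hφ : Lip ρ φ) : ∃ t : ℝ, LogLip ρ B (φ + ContinuousMap.const X t) := by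
  obtain ⟨c, hc⟩ := hφ
  -- Above the height `|c| / B`, an additive variation `|c| ρ` is a relative variation of at most `B
  -- ρ`.
  have hlow : ∀ x, |c| / B + 1 ≤ φ x + (‖φ‖ + |c| / B + 1) := by
    intro x
    have := neg_le_of_abs_le (φ.norm_coe_le_norm x)
    linarith
  have hcB : 0 ≤ |c| / B := by positivity
  refine ⟨‖φ‖ + |c| / B + 1, fun x => ?_, fun x y => ?_⟩
  · have := hlow x
    simp only [ContinuousMap.add_apply, ContinuousMap.const_apply]
    linarith
  · simp only [ContinuousMap.add_apply, ContinuousMap.const_apply]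
    have h0 := hρ x y
    have h1 : φ x - φ y ≤ |c| * ρ x y :=
      (le_abs_self _).trans ((hc x y).trans (mul_le_mul_of_nonneg_right (le_abs_self c) h0))
    have h2 := Real.add_one_le_exp (B * ρ x y)
    have h3 := hlow y
    have h4 : |c| ≤ B * (φ y + (‖φ‖ + |c| / B + 1)) := by
      have : B * (|c| / B) = |c| := by field_simp
      nlinarith
    set q := φ y + (‖φ‖ + |c| / B + 1)
    have h5 : |c| * ρ x y ≤ B * q * ρ x y := by gcongr
    have hq : 0 ≤ q := by linarith
    have h6 : (B * ρ x y + 1) * q ≤ Real.exp (B * ρ x y) * q := by gcongr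
    have h7 : φ x + (‖φ‖ + |c| / B + 1) ≤ q + |c| * ρ x y := by simp only [q]; linarith
    linarith

end Cone

/-! ### Iterates of a logarithmic contraction -/

namespace IsLogContraction

variable {X : Type*} [TopologicalSpace X] {ρ : X → X → ℝ} {D θ C : ℝ}
  {L : C(X, ℝ) →ₗ[ℝ] C(X, ℝ)}

theorem mono (hL : IsLogContraction ρ D θ C L) {φ ψ : C(X, ℝ)} (h : φ ≤ ψ) : L φ ≤ L ψ := by
  have := hL.map_nonneg (ψ - φ) (sub_nonneg.2 h)
  rwa [map_sub, sub_nonneg] at this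

theorem pow_mono (hL : IsLogContraction ρ D θ C L) {φ ψ : C(X, ℝ)} (h : φ ≤ ψ) (n : ℕ) :
    (L ^ n) φ ≤ (L ^ n) ψ := by
  induction n with
  | zero => simpa using h
  | succ n ih => simpa only [pow_succ', Module.End.mul_apply] using hL.mono ih

/-- The fixed point of `B ↦ θ * B + C`. -/
theorem fixed_rate (hL : IsLogContraction ρ D θ C L) :
    θ * (C / (1 - θ)) + C = C / (1 - θ) := by
  have : 1 - θ ≠ 0 := by linarith [hL.rate_lt_one]
  field_simp
  ring

theorem fixed_nonneg (hL : IsLogContraction ρ D θ C L) : 0 ≤ C / (1 - θ) :=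
  div_nonneg hL.error_nonneg (by linarith [hL.rate_lt_one])

/-- Starting from constant `0`, the iteration `B ↦ θ * B + C` never exceeds its fixed point. The
bound is uniform in `n`, so `L ^ n 1` can serve as a normalizer. -/
theorem logLip_pow_one (hL : IsLogContraction ρ D θ C L) (n : ℕ) :
    LogLip ρ (C / (1 - θ)) ((L ^ n) 1) := by
  induction n with
  | zero => simpa using LogLip.one.mono hL.gauge_nonneg hL.fixed_nonneg
  | succ n ih =>
    have := hL.map_logLip _ _ hL.fixed_nonneg ih
    rwa [hL.fixed_rate, ← Module.End.mul_apply, ← pow_succ'] at this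

/-- Positivity alone makes `φ ↦ L ^ n φ / L ^ n 1` nonexpansive in the sup norm, so limits pass from
a dense set to all continuous functions. -/
theorem norm_map_le [CompactSpace X] (hL : IsLogContraction ρ D θ C L) (φ : C(X, ℝ)) (n : ℕ) (x : X) :
    |(L ^ n) φ x| ≤ ‖φ‖ * (L ^ n) 1 x := by
  have h1 : φ ≤ ‖φ‖ • (1 : C(X, ℝ)) := ContinuousMap.le_def.2 fun y => by
    simpa using (le_abs_self _).trans (φ.norm_coe_le_norm y)
  have h2 : -(‖φ‖ • (1 : C(X, ℝ))) ≤ φ := ContinuousMap.le_def.2 fun y => by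
    simpa using neg_le_of_abs_le (φ.norm_coe_le_norm y)
  have h3 := ContinuousMap.le_def.1 (hL.pow_mono h1 n) x
  have h4 := ContinuousMap.le_def.1 (hL.pow_mono h2 n) x
  simp only [map_neg, map_smul, ContinuousMap.neg_apply, ContinuousMap.smul_apply,
    smul_eq_mul] at h3 h4
  exact abs_le.2 ⟨h4, h3⟩

end IsLogContraction

/-! ### Coupling and convergence of ratios -/

section

namespace IsLogContraction

variable {X : Type*} [TopologicalSpace X] {ρ : X → X → ℝ} {D θ C : ℝ}
  {L : C(X, ℝ) →ₗ[ℝ] C(X, ℝ)}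

/-- One step of the coupling: applying `L` splits off a definite part of the function. -/
theorem exists_split [Nonempty X] (hL : IsLogContraction ρ D θ C L) {B : ℝ}
    (hB : 2 * (C / (1 - θ)) + θ * B < B) :
    ∃ τ : ℝ, 0 < τ ∧ τ < 1 ∧ ∀ (n : ℕ) (ψ : C(X, ℝ)), LogLip ρ B ψ → ∀ s : ℝ, (∀ x, ψ x ≤ s) →
      ∃ (c : ℝ) (ψ' : C(X, ℝ)), LogLip ρ B ψ' ∧ (∀ x, ψ' x ≤ τ * s) ∧
        L ((L ^ n) 1 * ψ) = (L ^ (n + 1)) 1 * (ContinuousMap.const X c + ψ') := by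
  obtain ⟨x₀⟩ := ‹Nonempty X›
  set A := C / (1 - θ) with hA
  have hA0 : 0 ≤ A := hL.fixed_nonneg
  have hD0 : 0 ≤ D := (hL.gauge_nonneg x₀ x₀).trans (hL.gauge_le x₀ x₀)
  have hBpos : 0 < B := by
    have := hL.rate_lt_one
    by_contra! h
    nlinarith [hL.rate_nonneg]
  have hB'0 : 0 ≤ 2 * A + θ * B := by
    have := mul_nonneg hL.rate_nonneg hBpos.le
    linarith
  set δ := (B - (2 * A + θ * B)) / (B * Real.exp (B * D)) / 2 with hδ
  have hE : 1 ≤ Real.exp (B * D) := Real.one_le_exp (by positivity)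
  have hδ0 : 0 < δ := by
    have : 0 < B - (2 * A + θ * B) := by linarith
    positivity
  have hδ1 : δ ≤ 1 / 2 := by
    have : (B - (2 * A + θ * B)) / (B * Real.exp (B * D)) ≤ 1 := by
      rw [div_le_one (by positivity)]
      nlinarith
    linarith
  set e := Real.exp (-(B * D)) with he
  have he0 : 0 < e := Real.exp_pos _
  have he1 : e ≤ 1 := Real.exp_le_one_iff.2 (by nlinarith)
  have hee : e * Real.exp (B * D) = 1 := by rw [he, ← Real.exp_add]; simp
  have hδe : δ * e * e ≤ 1 / 2 := by
    have : e * e ≤ 1 := by nlinarith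
    nlinarith
  -- The constant removed is `δ * e * χ x₀`. One factor `e` keeps it below `δ * χ` everywhere; the
  -- other compares `χ x₀` with `χ x` when bounding what remains.
  refine ⟨1 - δ * e * e, by linarith, by linarith [mul_pos (mul_pos hδ0 he0) he0], ?_⟩
  intro n ψ hψ s hs
  have hu := hL.logLip_pow_one n
  have hu' := hL.logLip_pow_one (n + 1)
  set u := (L ^ n) 1
  set u' := (L ^ (n + 1)) 1 with hu'_def
  have hLu : L u = u' := by rw [hu'_def, pow_succ', Module.End.mul_apply]
  set χ := L (u * ψ) * recip u' hu'.1 with hχ_def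
  have hχ : LogLip ρ (2 * A + θ * B) χ := by
    have h := (hL.map_logLip _ _ (by linarith) (hu.mul hψ)).mul (hu'.recip hL.gauge_symm)
    -- The product with `u` costs `A` before `L` and division by `u'` costs `A` after it; the
    -- fixed-point identity `θ * A + C = A` merges the terms.
    have e1 : θ * (A + B) + C + A = 2 * A + θ * B := by
      have := hL.fixed_rate
      rw [← hA] at this
      linarith
    exact e1 ▸ h
  have hχu : L (u * ψ) = u' * χ := by
    ext x
    have := (hu'.1 x).ne'
    simp only [hχ_def, recip, ContinuousMap.mul_apply, ContinuousMap.coe_mk]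
    field_simp
  have hχs : ∀ x, χ x ≤ s := by
    intro x
    have h1 : u * ψ ≤ s • u := ContinuousMap.le_def.2 fun y => by
      have := mul_le_mul_of_nonneg_left (hs y) (hu.1 y).le
      simp only [ContinuousMap.mul_apply, ContinuousMap.smul_apply, smul_eq_mul]
      linarith
    have h2 := ContinuousMap.le_def.1 (hL.mono h1) x
    rw [hχu, map_smul, hLu] at h2
    simp only [ContinuousMap.mul_apply, ContinuousMap.smul_apply, smul_eq_mul] at h2
    have := hu'.1 x
    nlinarith
  have hcmp : ∀ x y, e * χ x ≤ χ y := by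
    intro x y
    have h1 := hχ.2 x y
    have h2 : Real.exp ((2 * A + θ * B) * ρ x y) ≤ Real.exp (B * D) := by
      apply Real.exp_le_exp.2
      exact mul_le_mul hB.le (hL.gauge_le x y) (hL.gauge_nonneg x y) hBpos.le
    have h3 : χ x ≤ Real.exp (B * D) * χ y :=
      h1.trans (mul_le_mul_of_nonneg_right h2 (hχ.1 y).le)
    calc e * χ x ≤ e * (Real.exp (B * D) * χ y) := by gcongr
      _ = χ y := by rw [← mul_assoc, hee, one_mul]
  refine ⟨δ * (e * χ x₀), χ - ContinuousMap.const X (δ * (e * χ x₀)), ?_, ?_, ?_⟩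
  · refine hχ.sub_const hL.gauge_nonneg hL.gauge_le hB'0 hB fun x => ?_
    exact mul_le_mul_of_nonneg_left (hcmp x₀ x) hδ0.le
  · intro x
    have h1 : δ * e * (e * χ x) ≤ δ * e * χ x₀ :=
      mul_le_mul_of_nonneg_left (hcmp x x₀) (by positivity)
    have h2 := mul_le_mul_of_nonneg_left (hχs x) (by linarith : 0 ≤ 1 - δ * e * e)
    simp only [ContinuousMap.sub_apply, ContinuousMap.const_apply]
    linarith
  · rw [hχu]
    congr 1
    abel

/-- `L ^ n φ` is asymptotic to a multiple of `L ^ n 1`, at a geometric rate. -/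
theorem exists_ratio_limit [CompactSpace X] [Nonempty X] (hL : IsLogContraction ρ D θ C L) {B : ℝ}
    (hB : 2 * (C / (1 - θ)) + θ * B < B) :
    ∃ τ : ℝ, 0 < τ ∧ τ < 1 ∧ ∀ φ : C(X, ℝ), LogLip ρ B φ → ∃ l K : ℝ, ∀ (n : ℕ) (x : X),
      |(L ^ n) φ x - l * (L ^ n) 1 x| ≤ K * τ ^ n * (L ^ n) 1 x := by
  obtain ⟨τ, hτ0, hτ1, hstep⟩ := hL.exists_split hB
  refine ⟨τ, hτ0, hτ1, fun φ hφ => ?_⟩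
  obtain ⟨x₀⟩ := ‹Nonempty X›
  -- Constants already split off pass through the normalized step unchanged; only the remainder is
  -- split again.
  have hdec : ∀ n : ℕ, ∃ (c : ℝ) (ψ : C(X, ℝ)), LogLip ρ B ψ ∧ (∀ x, ψ x ≤ ‖φ‖ * τ ^ n) ∧
      (L ^ n) φ = (L ^ n) 1 * (ContinuousMap.const X c + ψ) := by
    intro n
    induction n with
    | zero =>
      refine ⟨0, φ, hφ, fun x => ?_, ?_⟩
      · simpa using (le_abs_self _).trans (φ.norm_coe_le_norm x)
      · ext x; simp
    | succ n ih =>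
      obtain ⟨c, ψ, hψ, hs, heq⟩ := ih
      obtain ⟨c', ψ', hψ', hs', heq'⟩ := hstep n ψ hψ _ hs
      refine ⟨c + c', ψ', hψ', fun x => (hs' x).trans_eq (by ring), ?_⟩
      have h1 : (L ^ n) 1 * (ContinuousMap.const X c + ψ) = c • (L ^ n) 1 + (L ^ n) 1 * ψ := by
        ext x
        simp only [ContinuousMap.mul_apply, ContinuousMap.add_apply, ContinuousMap.const_apply,
          ContinuousMap.smul_apply, smul_eq_mul]
        ring
      rw [pow_succ', Module.End.mul_apply, heq, h1, map_add, map_smul, heq', Module.End.mul_apply,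
        pow_succ', Module.End.mul_apply]
      ext x
      simp only [ContinuousMap.mul_apply, ContinuousMap.add_apply, ContinuousMap.const_apply,
        ContinuousMap.smul_apply, smul_eq_mul]
      ring
  choose c ψ hψ hs heq using hdec
  have hu : ∀ n x, 0 < (L ^ n) 1 x := fun n => (hL.logLip_pow_one n).1
  have hb : ∀ n, c n • (L ^ n) 1 ≤ (L ^ n) φ ∧ (L ^ n) φ ≤ (c n + ‖φ‖ * τ ^ n) • (L ^ n) 1 := by
    intro n
    constructor <;> refine ContinuousMap.le_def.2 fun x => ?_ <;> rw [heq n] <;>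
      simp only [ContinuousMap.mul_apply, ContinuousMap.add_apply, ContinuousMap.const_apply,
        ContinuousMap.smul_apply, smul_eq_mul]
    · have := mul_pos (hu n x) ((hψ n).1 x)
      linarith
    · have := mul_le_mul_of_nonneg_left (hs n x) (hu n x).le
      linarith
  -- Applying `L` to the sandwich at time `n` puts the next ratio in the same interval as the
  -- current one, so consecutive ratios differ by at most its length.
  have hb' : ∀ n, c n • (L ^ (n + 1)) 1 ≤ (L ^ (n + 1)) φ ∧
      (L ^ (n + 1)) φ ≤ (c n + ‖φ‖ * τ ^ n) • (L ^ (n + 1)) 1 := by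
    intro n
    have h1 := hL.mono (hb n).1
    have h2 := hL.mono (hb n).2
    rw [map_smul] at h1 h2
    rw [pow_succ', Module.End.mul_apply, Module.End.mul_apply]
    exact ⟨h1, h2⟩
  set a : ℕ → ℝ := fun n => (L ^ n) φ x₀ / (L ^ n) 1 x₀ with ha
  have ha1 : ∀ n, c n ≤ a n ∧ a n ≤ c n + ‖φ‖ * τ ^ n := fun n =>
    ⟨(le_div_iff₀ (hu n x₀)).2 ((hb n).1 x₀), (div_le_iff₀ (hu n x₀)).2 ((hb n).2 x₀)⟩
  have ha2 : ∀ n, c n ≤ a (n + 1) ∧ a (n + 1) ≤ c n + ‖φ‖ * τ ^ n := fun n =>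
    ⟨(le_div_iff₀ (hu _ x₀)).2 ((hb' n).1 x₀), (div_le_iff₀ (hu _ x₀)).2 ((hb' n).2 x₀)⟩
  have hdist : ∀ n, dist (a n) (a (n + 1)) ≤ ‖φ‖ * τ ^ n := by
    intro n
    rw [Real.dist_eq, abs_le]
    have := ha1 n
    have := ha2 n
    constructor <;> linarith
  obtain ⟨l, hl⟩ := cauchySeq_tendsto_of_complete (cauchySeq_of_le_geometric τ ‖φ‖ hτ1 hdist)
  refine ⟨l, ‖φ‖ + ‖φ‖ / (1 - τ), fun n x => ?_⟩
  have h1 := dist_le_of_le_geometric_of_tendsto τ ‖φ‖ hτ1 hdist hl n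
  rw [Real.dist_eq] at h1
  have h2 := ContinuousMap.le_def.1 (hb n).1 x
  have h3 := ContinuousMap.le_def.1 (hb n).2 x
  simp only [ContinuousMap.smul_apply, smul_eq_mul] at h2 h3
  have h4 := ha1 n
  have h5 : |(L ^ n) φ x - a n * (L ^ n) 1 x| ≤ ‖φ‖ * τ ^ n * (L ^ n) 1 x := by
    have := hu n x
    rw [abs_le]
    constructor <;> nlinarith
  have h6 : |a n * (L ^ n) 1 x - l * (L ^ n) 1 x| ≤ ‖φ‖ * τ ^ n / (1 - τ) * (L ^ n) 1 x := by
    rw [← sub_mul, abs_mul, abs_of_pos (hu n x)]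
    exact mul_le_mul_of_nonneg_right h1 (hu n x).le
  calc |(L ^ n) φ x - l * (L ^ n) 1 x|
      ≤ |(L ^ n) φ x - a n * (L ^ n) 1 x| + |a n * (L ^ n) 1 x - l * (L ^ n) 1 x| :=
        abs_sub_le _ _ _
    _ ≤ ‖φ‖ * τ ^ n * (L ^ n) 1 x + ‖φ‖ * τ ^ n / (1 - τ) * (L ^ n) 1 x := add_le_add h5 h6
    _ = _ := by ring

/-- The normalized limit functional: `L ^ n φ / L ^ n 1` converges to a constant `Λ φ` for every
continuous `φ`, geometrically fast on Lipschitz functions. -/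
theorem exists_limit_functional [CompactSpace X] [Nonempty X] (hL : IsLogContraction ρ D θ C L)
    (hdense : Dense {φ : C(X, ℝ) | Lip ρ φ}) :
    ∃ (τ : ℝ) (Λ : C(X, ℝ) →ₗ[ℝ] ℝ), 0 < τ ∧ τ < 1 ∧ (∀ φ, 0 ≤ φ → 0 ≤ Λ φ) ∧ Λ 1 = 1 ∧
      (∀ φ x, Tendsto (fun n => (L ^ n) φ x / (L ^ n) 1 x) atTop (𝓝 (Λ φ))) ∧
      ∀ φ, Lip ρ φ → ∃ K : ℝ, ∀ (n : ℕ) (x : X),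
        |(L ^ n) φ x - Λ φ * (L ^ n) 1 x| ≤ K * τ ^ n * (L ^ n) 1 x := by
  have hθ := hL.rate_lt_one
  -- The fixed point of `B ↦ 2 * A + θ * B`, raised by one to make the inequality strict.
  set B := 2 * (C / (1 - θ)) / (1 - θ) + 1 with hBdef
  have hA := hL.fixed_nonneg
  have hBpos : 0 < B := by
    have : 0 < 1 - θ := by linarith
    positivity
  have hB : 2 * (C / (1 - θ)) + θ * B < B := by
    have h1 : (1 - θ) * (2 * (C / (1 - θ)) / (1 - θ)) = 2 * (C / (1 - θ)) :=
      mul_div_cancel₀ _ (by linarith)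
    have : (1 - θ) * B = 2 * (C / (1 - θ)) + (1 - θ) := by rw [hBdef, mul_add, h1, mul_one]
    linarith
  obtain ⟨τ, hτ0, hτ1, hlim⟩ := hL.exists_ratio_limit hB
  have hu : ∀ n x, 0 < (L ^ n) 1 x := fun n => (hL.logLip_pow_one n).1
  have hlip : ∀ φ, Lip ρ φ → ∃ l K : ℝ, ∀ (n : ℕ) (x : X),
      |(L ^ n) φ x - l * (L ^ n) 1 x| ≤ K * τ ^ n * (L ^ n) 1 x := by
    intro φ hφ
    obtain ⟨t, ht⟩ := hφ.exists_logLip_add_const hL.gauge_nonneg hBpos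
    obtain ⟨l, K, h⟩ := hlim _ ht
    refine ⟨l - t, K, fun n x => ?_⟩
    have h1 := h n x
    have h2 : ContinuousMap.const X t = t • (1 : C(X, ℝ)) := by ext; simp
    rw [h2, map_add, map_smul] at h1
    simp only [ContinuousMap.add_apply, ContinuousMap.smul_apply, smul_eq_mul] at h1
    rwa [show (L ^ n) φ x - (l - t) * (L ^ n) 1 x
      = (L ^ n) φ x + t * (L ^ n) 1 x - l * (L ^ n) 1 x by ring]
  have hratio : ∀ (φ : C(X, ℝ)) (l K : ℝ), (∀ (n : ℕ) (x : X),
      |(L ^ n) φ x - l * (L ^ n) 1 x| ≤ K * τ ^ n * (L ^ n) 1 x) →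
      ∀ n x, |(L ^ n) φ x / (L ^ n) 1 x - l| ≤ K * τ ^ n := by
    intro φ l K h n x
    have h1 := hu n x
    rw [div_sub' h1.ne', abs_div, abs_of_pos h1, div_le_iff₀ h1, mul_comm _ l]
    exact h n x
  have hK : ∀ K : ℝ, Tendsto (fun n : ℕ => K * τ ^ n) atTop (𝓝 0) := fun K => by
    simpa using (tendsto_pow_atTop_nhds_zero_of_lt_one hτ0.le hτ1).const_mul K
  -- distances of ratios are controlled by the sup norm
  have hnear : ∀ (φ ψ : C(X, ℝ)) n x,
      |(L ^ n) φ x / (L ^ n) 1 x - (L ^ n) ψ x / (L ^ n) 1 x| ≤ ‖φ - ψ‖ := by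
    intro φ ψ n x
    have h1 := hu n x
    rw [← sub_div, abs_div, abs_of_pos h1, div_le_iff₀ h1]
    have := hL.norm_map_le (φ - ψ) n x
    rwa [map_sub] at this
  have hconv : ∀ φ : C(X, ℝ), ∃ l : ℝ, ∀ x,
      Tendsto (fun n => (L ^ n) φ x / (L ^ n) 1 x) atTop (𝓝 l) := by
    intro φ
    -- One `m` serves all points at once: this gives both the Cauchy property at `x₀` and
    -- independence of the limit from `x`.
    have hunif : ∀ ε > 0, ∃ (m : ℝ) (N : ℕ), ∀ n ≥ N, ∀ x,
        |(L ^ n) φ x / (L ^ n) 1 x - m| < ε := by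
      intro ε hε
      obtain ⟨ψ, hψ, hd⟩ := Metric.dense_iff.1 hdense φ (ε / 2) (by linarith)
      obtain ⟨l, K, h⟩ := hlip ψ hd
      have h1 := (hK K).eventually (gt_mem_nhds (by linarith : 0 < ε / 2))
      obtain ⟨N, hN⟩ := eventually_atTop.1 h1
      refine ⟨l, N, fun n hn x => ?_⟩
      have h2 := hN n hn
      have h3 := hratio ψ l K h n x
      have h4 := hnear φ ψ n x
      rw [Metric.mem_ball, dist_comm, dist_eq_norm] at hψ
      calc _ ≤ _ := abs_sub_le _ ((L ^ n) ψ x / (L ^ n) 1 x) _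
        _ < ε := by linarith
    obtain ⟨x₀⟩ := ‹Nonempty X›
    have hc : CauchySeq fun n => (L ^ n) φ x₀ / (L ^ n) 1 x₀ := by
      refine Metric.cauchySeq_iff.2 fun ε hε => ?_
      obtain ⟨m, N, h⟩ := hunif (ε / 2) (by linarith)
      refine ⟨N, fun i hi j hj => ?_⟩
      have h1 := h i hi x₀
      have h2 := h j hj x₀
      rw [← Real.dist_eq] at h1 h2
      calc _ ≤ _ := dist_triangle_right _ _ m
        _ < ε := by linarith
    obtain ⟨l, hl⟩ := cauchySeq_tendsto_of_complete hc
    refine ⟨l, fun x => ?_⟩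
    have h0 : Tendsto (fun n => (L ^ n) φ x / (L ^ n) 1 x - (L ^ n) φ x₀ / (L ^ n) 1 x₀) atTop
        (𝓝 0) := by
      refine Metric.tendsto_atTop.2 fun ε hε => ?_
      obtain ⟨m, N, h⟩ := hunif (ε / 2) (by linarith)
      refine ⟨N, fun n hn => ?_⟩
      have h1 := h n hn x
      have h2 := h n hn x₀
      rw [abs_lt] at h1 h2
      rw [Real.dist_eq, sub_zero, abs_lt]
      constructor <;> linarith
    simpa using h0.add hl
  choose Λ hΛ using hconv
  obtain ⟨x₀⟩ := ‹Nonempty X›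
  refine ⟨τ, { toFun := Λ, map_add' := fun φ ψ => ?_, map_smul' := fun t φ => ?_ }, hτ0, hτ1,
    fun φ hφ => ?_, ?_, hΛ, fun φ hφ => ?_⟩
  · refine tendsto_nhds_unique (hΛ _ x₀) (((hΛ φ x₀).add (hΛ ψ x₀)).congr fun n => ?_)
    rw [map_add, ContinuousMap.add_apply, add_div]
  · refine tendsto_nhds_unique (hΛ _ x₀) (((hΛ φ x₀).const_mul t).congr fun n => ?_)
    rw [map_smul, ContinuousMap.smul_apply, smul_eq_mul, mul_div_assoc]
  · refine ge_of_tendsto' (hΛ φ x₀) fun n => div_nonneg ?_ (hu n x₀).le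
    have := hL.pow_mono hφ n x₀
    rwa [map_zero] at this
  · refine tendsto_nhds_unique (hΛ _ x₀) (tendsto_const_nhds.congr fun n => ?_)
    rw [div_self (hu n x₀).ne']
  · obtain ⟨l, K, h⟩ := hlip φ hφ
    have hl : Λ φ = l := by
      refine tendsto_nhds_unique (hΛ φ x₀) ?_
      rw [tendsto_iff_dist_tendsto_zero]
      exact squeeze_zero (fun _ => dist_nonneg) (fun n => by
        rw [Real.dist_eq]; exact hratio φ l K h n x₀) (hK K)
    exact ⟨K, fun n x => by simpa [hl] using h n x⟩

end IsLogContraction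

end

/-! ### Ruelle–Perron–Frobenius theorem and uniqueness -/

section

/-- A leading eigenvalue `lam` of `L`, with a positive eigenfunction `h` and a normalized positive
dual eigenfunctional `Λ`, and convergence of `lam⁻ⁿ Lⁿ φ` to `Λ φ • h` at the rate `τ`. -/
structure IsSpectralData {X : Type*} [TopologicalSpace X] (ρ : X → X → ℝ)
    (L : C(X, ℝ) →ₗ[ℝ] C(X, ℝ)) (A lam : ℝ) (h : C(X, ℝ)) (Λ : C(X, ℝ) →ₗ[ℝ] ℝ) (τ : ℝ) :
    Prop where
  lam_pos : 0 < lam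
  logLip : LogLip ρ A h
  map_eq : L h = lam • h
  nonneg : ∀ φ, 0 ≤ φ → 0 ≤ Λ φ
  map_one : Λ 1 = 1
  dual_eq : ∀ φ, Λ (L φ) = lam * Λ φ
  normalized : Λ h = 1
  rate_pos : 0 < τ
  rate_lt_one : τ < 1
  decay : ∀ φ, Lip ρ φ → ∃ K : ℝ, 0 < K ∧ ∀ (n : ℕ) (x : X),
    |(L ^ n) φ x - lam ^ n * (Λ φ * h x)| ≤ K * τ ^ n * lam ^ n

variable {X : Type*} [TopologicalSpace X] {ρ : X → X → ℝ} {D θ C : ℝ}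
  {L : C(X, ℝ) →ₗ[ℝ] C(X, ℝ)}

/-- A positive normalized functional takes values between the bounds of its argument. -/
theorem functional_le {Λ : C(X, ℝ) →ₗ[ℝ] ℝ} (hpos : ∀ φ, 0 ≤ φ → 0 ≤ Λ φ)
    (hone : Λ 1 = 1) {φ : C(X, ℝ)} {b : ℝ} (h : ∀ x, φ x ≤ b) : Λ φ ≤ b := by
  have h1 := hpos (b • 1 - φ) (ContinuousMap.le_def.2 fun x => by simpa using h x)
  rw [map_sub, map_smul, hone, smul_eq_mul, mul_one] at h1
  linarith

theorem le_functional {Λ : C(X, ℝ) →ₗ[ℝ] ℝ} (hpos : ∀ φ, 0 ≤ φ → 0 ≤ Λ φ)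
    (hone : Λ 1 = 1) {φ : C(X, ℝ)} {b : ℝ} (h : ∀ x, b ≤ φ x) : b ≤ Λ φ := by
  have h1 := hpos (φ - b • 1) (ContinuousMap.le_def.2 fun x => by simpa using h x)
  rw [map_sub, map_smul, hone, smul_eq_mul, mul_one] at h1
  linarith

theorem abs_functional_le [CompactSpace X] {Λ : C(X, ℝ) →ₗ[ℝ] ℝ}
    (hpos : ∀ φ, 0 ≤ φ → 0 ≤ Λ φ) (hone : Λ 1 = 1) (φ : C(X, ℝ)) : |Λ φ| ≤ ‖φ‖ :=
  abs_le.2 ⟨le_functional hpos hone fun x => neg_le_of_abs_le (φ.norm_coe_le_norm x),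
    functional_le hpos hone fun x => (le_abs_self _).trans (φ.norm_coe_le_norm x)⟩

theorem dual_pow_eq {lam : ℝ} {Λ' : C(X, ℝ) →ₗ[ℝ] ℝ} (heig : ∀ φ, Λ' (L φ) = lam * Λ' φ) (n : ℕ)
    (φ : C(X, ℝ)) : Λ' ((L ^ n) φ) = lam ^ n * Λ' φ := by
  induction n with
  | zero => simp
  | succ n ih => rw [pow_succ', Module.End.mul_apply, heig, ih]; ring

namespace IsLogContraction

theorem continuous_of_positive [CompactSpace X] (hL : IsLogContraction ρ D θ C L) :
    Continuous L := by
  refine AddMonoidHomClass.continuous_of_bound L ‖L 1‖ fun φ => ?_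
  refine (ContinuousMap.norm_le _ (by positivity)).2 fun x => ?_
  have h1 := hL.norm_map_le φ 1 x
  rw [pow_one] at h1
  have h2 : L 1 x ≤ ‖L 1‖ := (le_abs_self _).trans ((L 1).norm_coe_le_norm x)
  rw [Real.norm_eq_abs, mul_comm]
  exact h1.trans (mul_le_mul_of_nonneg_left h2 (norm_nonneg _))

/-- **Ruelle–Perron–Frobenius theorem** for logarithmic contractions. -/
theorem exists_spectralData [CompactSpace X] [Nonempty X] (hL : IsLogContraction ρ D θ C L)
    (hdense : Dense {φ : C(X, ℝ) | Lip ρ φ}) :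
    ∃ (lam : ℝ) (h : C(X, ℝ)) (Λ : C(X, ℝ) →ₗ[ℝ] ℝ) (τ : ℝ),
      IsSpectralData ρ L (C / (1 - θ)) lam h Λ τ := by
  obtain ⟨τ, Λ, hτ0, hτ1, hpos, hone, hlim, hlip⟩ := hL.exists_limit_functional hdense
  have hu : ∀ n x, 0 < (L ^ n) 1 x := fun n => (hL.logLip_pow_one n).1
  have hA := hL.fixed_nonneg
  set A := C / (1 - θ) with hAdef
  have hL1 : LogLip ρ C (L 1) := by
    simpa using hL.map_logLip 0 1 le_rfl LogLip.one
  set lam := Λ (L 1) with hlam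
  have hlam0 : 0 < lam := by
    obtain ⟨x₀⟩ := ‹Nonempty X›
    have h1 : ∀ x, Real.exp (-(C * D)) * L 1 x₀ ≤ L 1 x := fun x => by
      rw [Real.exp_neg, inv_mul_le_iff₀ (Real.exp_pos _)]
      refine (hL1.2 x₀ x).trans (mul_le_mul_of_nonneg_right ?_ (hL1.1 x).le)
      exact Real.exp_le_exp.2 (mul_le_mul_of_nonneg_left (hL.gauge_le _ _) hL.error_nonneg)
    exact (mul_pos (Real.exp_pos _) (hL1.1 x₀)).trans_le (le_functional hpos hone h1)
  have heig : ∀ φ, Λ (L φ) = lam * Λ φ := by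
    intro φ
    obtain ⟨x₀⟩ := ‹Nonempty X›
    -- The ratio for `L φ` at time `n` is the ratio for `L 1` at time `n` times the ratio for `φ` at
    -- time `n + 1`.
    refine tendsto_nhds_unique (hlim (L φ) x₀)
      (((hlim (L 1) x₀).mul ((hlim φ x₀).comp (tendsto_add_atTop_nat 1))).congr fun n => ?_)
    have h1 := (hu n x₀).ne'
    have h2 := (hu (n + 1) x₀).ne'
    have e : ∀ χ : C(X, ℝ), (L ^ n) (L χ) = (L ^ (n + 1)) χ := fun χ => by
      rw [pow_succ, Module.End.mul_apply]
    simp only [Function.comp, e]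
    field_simp
  set g : ℕ → C(X, ℝ) := fun n => (lam ^ n)⁻¹ • (L ^ n) 1 with hg
  have hgL : ∀ n, LogLip ρ A (g n) := by
    intro n
    have h0 : 0 < (lam ^ n)⁻¹ := by positivity
    refine ⟨fun x => mul_pos h0 (hu n x), fun x y => ?_⟩
    have := mul_le_mul_of_nonneg_left ((hL.logLip_pow_one n).2 x y) h0.le
    simp only [hg, ContinuousMap.smul_apply, smul_eq_mul]
    linarith
  have hgone : ∀ n, Λ (g n) = 1 := by
    intro n
    simp only [hg]
    rw [map_smul, dual_pow_eq heig, hone, mul_one, smul_eq_mul, inv_mul_cancel₀ (by positivity)]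
  have hexp : ∀ x y, Real.exp (A * ρ x y) ≤ Real.exp (A * D) := fun x y =>
    Real.exp_le_exp.2 (mul_le_mul_of_nonneg_left (hL.gauge_le _ _) hA)
  set E := Real.exp (A * D) with hE
  have hE0 : 0 < E := Real.exp_pos _
  -- Values of `g n` differ by a factor of at most `E`, and its `Λ`-mean is `1`; this pins it
  -- between `E⁻¹` and `E`.
  have hgup : ∀ n x, g n x ≤ E := by
    intro n x
    have h1 : E⁻¹ * g n x ≤ Λ (g n) := le_functional hpos hone fun y => by
      rw [inv_mul_le_iff₀ hE0]
      exact ((hgL n).2 x y).trans (mul_le_mul_of_nonneg_right (hexp x y) ((hgL n).1 y).le)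
    rw [hgone, inv_mul_le_iff₀ hE0] at h1
    linarith
  have hglow : ∀ n x, E⁻¹ ≤ g n x := by
    intro n x
    have h1 : Λ (g n) ≤ E * g n x := functional_le hpos hone fun y =>
      ((hgL n).2 y x).trans (mul_le_mul_of_nonneg_right (hexp y x) ((hgL n).1 x).le)
    rw [hgone] at h1
    rwa [inv_le_iff_one_le_mul₀ hE0, mul_comm]
  -- The rate for `L 1` bounds `L ^ (n + 1) 1 - lam * L ^ n 1`, making `g` Cauchy in sup norm.
  obtain ⟨K₁, hK₁⟩ := hlip (L 1)
    (hL1.lip hL.gauge_nonneg hL.gauge_symm hL.gauge_le hL.error_nonneg)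
  have hK₁0 : 0 ≤ K₁ := by
    obtain ⟨x₀⟩ := ‹Nonempty X›
    have h1 := (abs_nonneg _).trans (hK₁ 0 x₀)
    simpa using h1
  have hdist : ∀ n, dist (g n) (g (n + 1)) ≤ K₁ * E / lam * τ ^ n := by
    intro n
    rw [dist_comm, dist_eq_norm]
    refine (ContinuousMap.norm_le _ (by positivity)).2 fun x => ?_
    have h1 := hK₁ n x
    rw [← Module.End.mul_apply, ← pow_succ, ← hlam] at h1
    have h2 := hgup n x
    have e1 : (g (n + 1) - g n) x =
        (lam ^ (n + 1))⁻¹ * ((L ^ (n + 1)) 1 x - lam * (L ^ n) 1 x) := by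
      simp only [hg, ContinuousMap.sub_apply, ContinuousMap.smul_apply, smul_eq_mul]
      rw [pow_succ]
      field_simp
    rw [Real.norm_eq_abs, e1, abs_mul, abs_of_pos (by positivity)]
    calc (lam ^ (n + 1))⁻¹ * |(L ^ (n + 1)) 1 x - lam * (L ^ n) 1 x|
        ≤ (lam ^ (n + 1))⁻¹ * (K₁ * τ ^ n * (L ^ n) 1 x) := by gcongr
      _ = K₁ * τ ^ n / lam * g n x := by
          simp only [hg, ContinuousMap.smul_apply, smul_eq_mul]
          rw [pow_succ]
          field_simp
      _ ≤ K₁ * τ ^ n / lam * E := by gcongr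
      _ = _ := by ring
  obtain ⟨h, hh⟩ := cauchySeq_tendsto_of_complete (cauchySeq_of_le_geometric τ _ hτ1 hdist)
  have hhx : ∀ x, Tendsto (fun n => g n x) atTop (𝓝 (h x)) := fun x =>
    ((continuous_eval_const x : Continuous fun f : C(X, ℝ) => f x).tendsto h).comp hh
  have hgh : ∀ n, ‖g n - h‖ ≤ K₁ * E / lam * τ ^ n / (1 - τ) := fun n => by
    rw [← dist_eq_norm]
    exact dist_le_of_le_geometric_of_tendsto τ _ hτ1 hdist hh n
  have hone' : Λ h = 1 := by
    have h1 : Tendsto (fun n => Λ (g n)) atTop (𝓝 (Λ h)) := by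
      rw [tendsto_iff_dist_tendsto_zero]
      refine squeeze_zero (fun _ => dist_nonneg) (fun n => ?_)
        (tendsto_iff_dist_tendsto_zero.1 hh)
      rw [Real.dist_eq, ← map_sub, dist_eq_norm]
      exact abs_functional_le hpos hone _
    refine tendsto_nhds_unique h1 ?_
    simp only [hgone]
    exact tendsto_const_nhds
  have hLh : L h = lam • h := by
    have h1 : Tendsto (fun n => L (g n)) atTop (𝓝 (L h)) :=
      (hL.continuous_of_positive.tendsto h).comp hh
    refine tendsto_nhds_unique h1
      (((hh.comp (tendsto_add_atTop_nat 1)).const_smul lam).congr fun n => ?_)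
    simp only [hg, Function.comp]
    rw [map_smul, smul_smul, ← Module.End.mul_apply, ← pow_succ']
    congr 1
    rw [pow_succ]
    field_simp
  refine ⟨lam, h, Λ, τ, hlam0, ⟨fun x => ?_, fun x y => ?_⟩, hLh, hpos, hone, heig, hone', hτ0, hτ1,
    fun φ hφ => ?_⟩
  · exact (inv_pos.2 hE0).trans_le (ge_of_tendsto' (hhx x) fun n => hglow n x)
  · exact le_of_tendsto_of_tendsto' (hhx x) ((hhx y).const_mul _) fun n => (hgL n).2 x y
  · obtain ⟨K₂, hK₂⟩ := hlip φ hφ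
    have hK₂0 : 0 ≤ K₂ := by
      obtain ⟨x₀⟩ := ‹Nonempty X›
      have h1 := (abs_nonneg _).trans (hK₂ 0 x₀)
      simpa using h1
    have hτ' : 0 < 1 - τ := by linarith
    refine ⟨K₂ * E + |Λ φ| * (K₁ * E / lam / (1 - τ)) + 1, by positivity, fun n x => ?_⟩
    have h0 : 0 < lam ^ n := by positivity
    have e1 : (L ^ n) 1 x = lam ^ n * g n x := by
      simp only [hg, ContinuousMap.smul_apply, smul_eq_mul]
      field_simp
    have h1 := hK₂ n x
    rw [e1] at h1
    have h2 : |g n x - h x| ≤ K₁ * E / lam * τ ^ n / (1 - τ) :=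
      ((g n - h).norm_coe_le_norm x).trans (hgh n)
    have h3 := hgup n x
    have h4 : 0 < τ ^ n := by positivity
    calc |(L ^ n) φ x - lam ^ n * (Λ φ * h x)|
        ≤ |(L ^ n) φ x - Λ φ * (lam ^ n * g n x)| +
          |Λ φ * (lam ^ n * g n x) - lam ^ n * (Λ φ * h x)| := abs_sub_le _ _ _
      _ = |(L ^ n) φ x - Λ φ * (lam ^ n * g n x)| + lam ^ n * |Λ φ| * |g n x - h x| := by
          rw [show Λ φ * (lam ^ n * g n x) - lam ^ n * (Λ φ * h x)
            = lam ^ n * Λ φ * (g n x - h x) by ring, abs_mul, abs_mul, abs_of_pos h0]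
      _ ≤ K₂ * τ ^ n * (lam ^ n * E) +
          lam ^ n * |Λ φ| * (K₁ * E / lam * τ ^ n / (1 - τ)) := by
          refine add_le_add (h1.trans ?_) ?_ <;> gcongr
      _ = (K₂ * E + |Λ φ| * (K₁ * E / lam / (1 - τ))) * τ ^ n * lam ^ n := by ring
      _ ≤ _ := by
          rw [mul_assoc, mul_assoc]
          exact mul_le_mul_of_nonneg_right (by linarith) (by positivity)

end IsLogContraction

namespace IsSpectralData

variable {A lam τ : ℝ} {h : C(X, ℝ)} {Λ : C(X, ℝ) →ₗ[ℝ] ℝ}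

theorem pow_map_eq {lam' : ℝ} {h' : C(X, ℝ)} (heig : L h' = lam' • h') (n : ℕ) :
    (L ^ n) h' = lam' ^ n • h' := by
  induction n with
  | zero => simp
  | succ n ih => rw [pow_succ', Module.End.mul_apply, ih, map_smul, heig, smul_smul, pow_succ]

theorem abs_div_pow_le (hS : IsSpectralData ρ L A lam h Λ τ) {φ : C(X, ℝ)} (hφ : Lip ρ φ) :
    ∃ K : ℝ, 0 < K ∧ ∀ (n : ℕ) (x : X), |(L ^ n) φ x / lam ^ n - Λ φ * h x| ≤ K * τ ^ n := by
  obtain ⟨K, hK0, hK⟩ := hS.decay φ hφ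
  refine ⟨K, hK0, fun n x => ?_⟩
  have h0 : 0 < lam ^ n := pow_pos hS.lam_pos n
  rw [div_sub' h0.ne', abs_div, abs_of_pos h0, div_le_iff₀ h0]
  exact hK n x

theorem tendsto_rate (hS : IsSpectralData ρ L A lam h Λ τ) (K : ℝ) :
    Tendsto (fun n : ℕ => K * τ ^ n) atTop (𝓝 0) := by
  simpa using (tendsto_pow_atTop_nhds_zero_of_lt_one hS.rate_pos.le hS.rate_lt_one).const_mul K

theorem tendsto_div_pow (hS : IsSpectralData ρ L A lam h Λ τ) {φ : C(X, ℝ)} (hφ : Lip ρ φ)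
    (x : X) : Tendsto (fun n => (L ^ n) φ x / lam ^ n) atTop (𝓝 (Λ φ * h x)) := by
  obtain ⟨K, -, hK⟩ := hS.abs_div_pow_le hφ
  rw [tendsto_iff_dist_tendsto_zero]
  exact squeeze_zero (fun _ => dist_nonneg) (fun n => hK n x) (hS.tendsto_rate K)

/-- The leading eigenvalue is unique and simple among positive Lipschitz eigenfunctions. -/
theorem eigenfunction_unique [CompactSpace X] [Nonempty X] (hS : IsSpectralData ρ L A lam h Λ τ)
    {lam' : ℝ} {h' : C(X, ℝ)} (hlip : Lip ρ h') (hpos : ∀ x, 0 < h' x)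
    (heig : L h' = lam' • h') : lam' = lam ∧ h' = Λ h' • h := by
  have hlam := hS.lam_pos
  have hΛ : 0 < Λ h' := by
    obtain ⟨x₀, -, hx₀⟩ := isCompact_univ.exists_isMinOn Set.univ_nonempty h'.continuous.continuousOn
    exact (hpos x₀).trans_le (le_functional hS.nonneg hS.map_one fun x => hx₀ (Set.mem_univ x))
  have hlim : ∀ x, Tendsto (fun n : ℕ => (lam' / lam) ^ n * h' x) atTop (𝓝 (Λ h' * h x)) := by
    intro x
    refine (hS.tendsto_div_pow hlip x).congr fun n => ?_
    rw [pow_map_eq heig, ContinuousMap.smul_apply, smul_eq_mul, div_pow]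
    ring
  -- Shifting the index multiplies the sequence by `lam' / lam` but keeps its nonzero limit.
  have hr : lam' / lam = 1 := by
    obtain ⟨x₀⟩ := ‹Nonempty X›
    have h1 := ((hlim x₀).comp (tendsto_add_atTop_nat 1))
    have h2 := (hlim x₀).const_mul (lam' / lam)
    have h3 := tendsto_nhds_unique h1 (h2.congr fun n => by simp only [Function.comp]; ring)
    have h4 := (mul_pos hΛ (hS.logLip.1 x₀)).ne'
    field_simp at h3 ⊢
    exact (mul_left_cancel₀ (hS.logLip.1 x₀).ne' h3).symm
  refine ⟨(div_eq_one_iff_eq hlam.ne').1 hr, ?_⟩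
  ext x
  refine tendsto_nhds_unique ?_ (hlim x)
  simp only [hr, one_pow, one_mul]
  exact tendsto_const_nhds

/-- The dual eigenfunctional is unique among normalized positive functionals. -/
theorem functional_unique [CompactSpace X] (hS : IsSpectralData ρ L A lam h Λ τ)
    (hdense : Dense {φ : C(X, ℝ) | Lip ρ φ}) {Λ' : C(X, ℝ) →ₗ[ℝ] ℝ}
    (hpos : ∀ φ, 0 ≤ φ → 0 ≤ Λ' φ) (hone : Λ' 1 = 1) (heig : ∀ φ, Λ' (L φ) = lam * Λ' φ)
    (φ : C(X, ℝ)) : Λ' φ = Λ φ := by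
  have hlam := hS.lam_pos
  have hlip : ∀ φ, Lip ρ φ → Λ' φ = Λ φ * Λ' h := by
    intro φ hφ
    obtain ⟨K, -, hK⟩ := hS.abs_div_pow_le hφ
    -- Duality removes `n` from the left side, so the decaying bound forces it to vanish.
    have h1 : ∀ n : ℕ, |Λ' φ - Λ φ * Λ' h| ≤ K * τ ^ n := by
      intro n
      have h0 : 0 < lam ^ n := pow_pos hlam n
      have e1 : Λ' ((lam ^ n)⁻¹ • (L ^ n) φ - Λ φ • h) = Λ' φ - Λ φ * Λ' h := by
        rw [map_sub, map_smul, map_smul, dual_pow_eq heig, smul_eq_mul, smul_eq_mul,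
          inv_mul_cancel_left₀ h0.ne']
      have h2 : ∀ x, |((lam ^ n)⁻¹ • (L ^ n) φ - Λ φ • h) x| ≤ K * τ ^ n := fun x => by
        have := hK n x
        rw [div_eq_inv_mul] at this
        simpa using this
      rw [← e1, abs_le]
      exact ⟨le_functional hpos hone fun x => (abs_le.1 (h2 x)).1,
        functional_le hpos hone fun x => (abs_le.1 (h2 x)).2⟩
    have h3 := le_of_tendsto_of_tendsto' tendsto_const_nhds (hS.tendsto_rate K) h1
    exact sub_eq_zero.1 (abs_eq_zero.1 (le_antisymm h3 (abs_nonneg _)))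
  have hh : Λ' h = 1 := by
    have := hlip 1 ⟨0, by simp⟩
    rwa [hone, hS.map_one, one_mul, eq_comm] at this
  have hcont : ∀ {Ψ : C(X, ℝ) →ₗ[ℝ] ℝ}, (∀ φ, 0 ≤ φ → 0 ≤ Ψ φ) → Ψ 1 = 1 → Continuous Ψ :=
    fun {Ψ} h1 h2 => AddMonoidHomClass.continuous_of_bound Ψ 1 fun φ => by
      rw [one_mul]
      exact abs_functional_le h1 h2 φ
  refine congrFun (Continuous.ext_on hdense (hcont hpos hone)
    (hcont hS.nonneg hS.map_one) fun ψ hψ => ?_) φ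
  rw [hlip ψ hψ, hh, mul_one]

end IsSpectralData

end

/-! ### Geometry of the sequence space -/

section Metric

variable {M : Type*} [MetricSpace M] [CompactSpace M]

theorem dist_le_diam (a b : M) : dist a b ≤ Metric.diam (Set.univ : Set M) :=
  Metric.dist_le_diam_of_mem isCompact_univ.isBounded (Set.mem_univ a) (Set.mem_univ b)

theorem summable_weight (D : ℝ) : Summable fun n : ℕ => (1 / 2 : ℝ) ^ (n + 1) * D :=
  ((summable_nat_add_iff 1).2 summable_geometric_two).mul_right D

theorem summable_seqDist (x y : ℕ → M) :
    Summable fun n : ℕ => (1 / 2 : ℝ) ^ (n + 1) * dist (x n) (y n) :=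
  Summable.of_nonneg_of_le (fun n => by positivity)
    (fun n => mul_le_mul_of_nonneg_left (dist_le_diam _ _) (by positivity)) (summable_weight _)

omit [CompactSpace M] in
theorem seqDist_nonneg (x y : ℕ → M) : 0 ≤ seqDist x y :=
  tsum_nonneg fun n => by positivity

omit [CompactSpace M] in
theorem seqDist_comm (x y : ℕ → M) : seqDist x y = seqDist y x := by
  simp only [seqDist, dist_comm]

omit [CompactSpace M] in
theorem seqDist_self (x : ℕ → M) : seqDist x x = 0 := by
  simp [seqDist]

theorem seqDist_le_diam (x y : ℕ → M) : seqDist x y ≤ Metric.diam (Set.univ : Set M) := by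
  have h1 : ∑' n : ℕ, (1 / 2 : ℝ) ^ (n + 1) * Metric.diam (Set.univ : Set M)
      = Metric.diam (Set.univ : Set M) := by
    have : ∑' n : ℕ, (1 / 2 : ℝ) ^ (n + 1) = 1 := by
      have h := summable_geometric_two.tsum_eq_zero_add
      rw [tsum_geometric_two] at h
      norm_num at h ⊢
      linarith
    rw [tsum_mul_right, this, one_mul]
  rw [← h1]
  exact (summable_seqDist x y).tsum_le_tsum
    (fun n => mul_le_mul_of_nonneg_left (dist_le_diam _ _) (by positivity)) (summable_weight _)

theorem dist_le_seqDist (x y : ℕ → M) (n : ℕ) : dist (x n) (y n) ≤ 2 ^ (n + 1) * seqDist x y := by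
  have h := (summable_seqDist x y).le_tsum n fun m _ => by positivity
  calc dist (x n) (y n) = 2 ^ (n + 1) * ((1 / 2 : ℝ) ^ (n + 1) * dist (x n) (y n)) := by
        rw [← mul_assoc, ← mul_pow]; norm_num
    _ ≤ _ := by unfold seqDist; gcongr

/-- The common first symbol contributes nothing and every other term moves one place, halving its
weight. All contraction in the proof comes from here. -/
theorem seqDist_cons (a : M) (x y : ℕ → M) :
    seqDist (cons a x) (cons a y) = 1 / 2 * seqDist x y := by
  unfold seqDist
  rw [(summable_seqDist (cons a x) (cons a y)).tsum_eq_zero_add, ← tsum_mul_left]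
  simp only [cons, dist_self, mul_zero, zero_add]
  exact tsum_congr fun n => by ring

theorem continuous_seqDist (y : ℕ → M) : Continuous fun x => seqDist x y := by
  refine continuous_tsum (fun n => by fun_prop) (summable_weight (Metric.diam (Set.univ : Set M)))
    fun n x => ?_
  rw [Real.norm_of_nonneg (by positivity)]
  exact mul_le_mul_of_nonneg_left (dist_le_diam _ _) (by positivity)

theorem IsHolder.continuous {α : ℝ} (hα : 0 < α) {g : (ℕ → M) → ℝ} (hg : IsHolder α g) :
    Continuous g := by
  obtain ⟨c, hc⟩ := hg
  refine continuous_iff_continuousAt.2 fun y => ?_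
  have h1 : Tendsto (fun x => c * seqDist x y ^ α) (𝓝 y) (𝓝 0) := by
    have := (((continuous_seqDist y).rpow_const fun _ => Or.inr hα.le).const_mul c).tendsto y
    simpa [seqDist_self, hα.ne'] using this
  rw [ContinuousAt, tendsto_iff_dist_tendsto_zero]
  exact squeeze_zero (fun _ => dist_nonneg) (fun x => hc x y) h1

/-- The gauge `d_Ω ^ α` with respect to which Hölder functions are Lipschitz. -/
noncomputable def gauge (α : ℝ) (x y : ℕ → M) : ℝ := seqDist x y ^ α

omit [CompactSpace M] in
theorem gauge_nonneg (α : ℝ) (x y : ℕ → M) : 0 ≤ gauge α x y :=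
  Real.rpow_nonneg (seqDist_nonneg x y) α

theorem gauge_le {α : ℝ} (hα : 0 < α) (x y : ℕ → M) :
    gauge α x y ≤ Metric.diam (Set.univ : Set M) ^ α :=
  Real.rpow_le_rpow (seqDist_nonneg x y) (seqDist_le_diam x y) hα.le

theorem gauge_cons (α : ℝ) (a : M) (x y : ℕ → M) :
    gauge α (cons a x) (cons a y) = (1 / 2) ^ α * gauge α x y := by
  rw [gauge, seqDist_cons, Real.mul_rpow (by norm_num) (seqDist_nonneg x y), gauge]

omit [CompactSpace M] in
theorem Lip.mul_of_bounded {α : ℝ} {φ ψ : C(ℕ → M, ℝ)} (hφ : Lip (gauge α) φ) (hψ : Lip (gauge α) ψ)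
    {b : ℝ} (hb : ∀ x, |φ x| ≤ b) (hb' : ∀ x, |ψ x| ≤ b) : Lip (gauge α) (φ * ψ) := by
  obtain ⟨c, hc⟩ := hφ
  obtain ⟨c', hc'⟩ := hψ
  refine ⟨b * c' + b * c, fun x y => ?_⟩
  have h0 : 0 ≤ b := (abs_nonneg _).trans (hb x)
  have e : φ x * ψ x - φ y * ψ y = φ x * (ψ x - ψ y) + ψ y * (φ x - φ y) := by ring
  simp only [ContinuousMap.mul_apply]
  rw [e]
  calc _ ≤ |φ x| * |ψ x - ψ y| + |ψ y| * |φ x - φ y| := by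
        rw [← abs_mul, ← abs_mul]; exact abs_add_le _ _
    _ ≤ b * (c' * gauge α x y) + b * (c * gauge α x y) :=
        add_le_add (mul_le_mul (hb x) (hc' x y) (abs_nonneg _) h0)
          (mul_le_mul (hb' y) (hc x y) (abs_nonneg _) h0)
    _ = _ := by ring

theorem Lip.mul {α : ℝ} {φ ψ : C(ℕ → M, ℝ)} (hφ : Lip (gauge α) φ) (hψ : Lip (gauge α) ψ) :
    Lip (gauge α) (φ * ψ) :=
  hφ.mul_of_bounded hψ (fun x => (φ.norm_coe_le_norm x).trans (le_max_left _ ‖ψ‖))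
    fun x => (ψ.norm_coe_le_norm x).trans (le_max_right ‖φ‖ _)

/-- The algebra of Hölder functions. -/
noncomputable def holderSubalgebra (M : Type*) [MetricSpace M] [CompactSpace M] (α : ℝ) :
    Subalgebra ℝ C(ℕ → M, ℝ) where
  carrier := {φ | Lip (gauge α) φ}
  mul_mem' := fun ha hb => ha.mul hb
  add_mem' := by
    rintro φ ψ ⟨c, hc⟩ ⟨c', hc'⟩
    refine ⟨c + c', fun x y => ?_⟩
    have e : (φ + ψ) x - (φ + ψ) y = (φ x - φ y) + (ψ x - ψ y) := by
      simp only [ContinuousMap.add_apply]; ring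
    rw [e, add_mul]
    exact (abs_add_le _ _).trans (add_le_add (hc x y) (hc' x y))
  algebraMap_mem' := fun r => ⟨0, fun x y => by simp⟩

/-- Stone–Weierstrass for the algebra of Hölder functions. The functions `z ↦ dist (z n) (y n)`
separate points; they are Lipschitz for `d_Ω`, hence `α`-Hölder because `d_Ω` is bounded and `α <
1`. -/
theorem dense_lip {α : ℝ} (hα0 : 0 < α) (hα1 : α < 1) :
    Dense {φ : C(ℕ → M, ℝ) | Lip (gauge α) φ} := by
  have h := ContinuousMap.subalgebra_topologicalClosure_eq_top_of_separatesPoints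
    (holderSubalgebra M α) ?_
  · intro φ
    have h1 : φ ∈ (holderSubalgebra M α).topologicalClosure := by rw [h]; trivial
    exact h1
  · intro x y hxy
    obtain ⟨n, hn⟩ := Function.ne_iff.1 hxy
    refine ⟨fun z => dist (z n) (y n),
      ⟨⟨fun z => dist (z n) (y n), by fun_prop⟩, ?_, rfl⟩, by simpa using hn⟩
    set D := Metric.diam (Set.univ : Set M)
    refine ⟨2 ^ (n + 1) * D ^ (1 - α), fun z w => ?_⟩
    have h1 : |dist (z n) (y n) - dist (w n) (y n)| ≤ dist (z n) (w n) := abs_dist_sub_le _ _ _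
    have h2 : seqDist z w ≤ D ^ (1 - α) * seqDist z w ^ α := by
      rcases (seqDist_nonneg z w).eq_or_lt with h0 | h0
      · rw [← h0, Real.zero_rpow hα0.ne', mul_zero]
      · calc seqDist z w = seqDist z w ^ (1 - α) * seqDist z w ^ α := by
              rw [← Real.rpow_add h0]; simp
          _ ≤ _ := by
              gcongr
              exact seqDist_le_diam z w
    calc _ ≤ dist (z n) (w n) := h1
      _ ≤ 2 ^ (n + 1) * seqDist z w := dist_le_seqDist z w n
      _ ≤ 2 ^ (n + 1) * (D ^ (1 - α) * seqDist z w ^ α) := by gcongr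
      _ = _ := by rw [gauge]; ring

end Metric

/-- Riesz–Markov–Kakutani: on a compact space every continuous function is compactly supported, and
testing on `1` gives total mass one. -/
theorem exists_measure_of_positive {X : Type*} [TopologicalSpace X] [T2Space X] [CompactSpace X]
    [MeasurableSpace X] [BorelSpace X] {Λ : C(X, ℝ) →ₗ[ℝ] ℝ} (hpos : ∀ φ, 0 ≤ φ → 0 ≤ Λ φ)
    (hone : Λ 1 = 1) :
    ∃ ν : Measure X, IsProbabilityMeasure ν ∧ ∀ φ : C(X, ℝ), ∫ x, φ x ∂ν = Λ φ := by
  let T : CompactlySupportedContinuousMap X ℝ →ₗ[ℝ] ℝ :=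
    { toFun := fun φ => Λ φ.toContinuousMap
      map_add' := fun φ ψ => Λ.map_add φ.toContinuousMap ψ.toContinuousMap
      map_smul' := fun c φ => Λ.map_smul c φ.toContinuousMap }
  let P : CompactlySupportedContinuousMap X ℝ →ₚ[ℝ] ℝ :=
    PositiveLinearMap.mk₀ T fun φ hφ => hpos _ hφ
  have hint : ∀ φ : C(X, ℝ), ∫ x, φ x ∂(RealRMK.rieszMeasure P) = Λ φ := fun φ =>
    RealRMK.integral_rieszMeasure P (CompactlySupportedContinuousMap.continuousMapEquiv φ)
  refine ⟨RealRMK.rieszMeasure P, ⟨?_⟩, hint⟩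
  have h1 := hint 1
  rw [hone] at h1
  simp only [ContinuousMap.one_apply, integral_const, smul_eq_mul, mul_one] at h1
  rw [Measure.real, ENNReal.toReal_eq_one_iff] at h1
  exact h1

/-! ### The Ruelle operator -/

section Operator

variable {M : Type*}

theorem shift_cons (a : M) (x : ℕ → M) : shift (cons a x) = x := rfl

theorem continuous_shift [TopologicalSpace M] : Continuous (shift : (ℕ → M) → ℕ → M) :=
  continuous_pi fun n => continuous_apply (n + 1)

theorem continuous_cons [TopologicalSpace M] :
    Continuous fun p : (ℕ → M) × M => cons p.2 p.1 := by
  refine continuous_pi fun n => ?_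
  cases n with
  | zero => exact continuous_snd
  | succ n => exact (continuous_apply n).comp continuous_fst

variable [MetricSpace M] [CompactSpace M] [MeasurableSpace M] [BorelSpace M]

theorem continuous_ruelleOp (μ : Measure M) [IsFiniteMeasure μ] (f φ : C(ℕ → M, ℝ)) :
    Continuous (ruelleOp μ f φ) := by
  have h : Continuous (Function.uncurry fun (x : ℕ → M) (a : M) =>
      Real.exp (f (cons a x)) * φ (cons a x)) :=
    (Real.continuous_exp.comp (f.continuous.comp continuous_cons)).mul
      (φ.continuous.comp continuous_cons)
  have := continuous_parametric_integral_of_continuous (μ := μ) h isCompact_univ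
  rw [Measure.restrict_univ] at this
  exact this

theorem integrable_ruelleOp (μ : Measure M) [IsFiniteMeasure μ] (f φ : C(ℕ → M, ℝ)) (x : ℕ → M) :
    Integrable (fun a => Real.exp (f (cons a x)) * φ (cons a x)) μ := by
  have hc : Continuous fun a : M => cons a x := continuous_cons.comp (Continuous.prodMk_right x)
  have h : Continuous fun a => Real.exp (f (cons a x)) * φ (cons a x) := by fun_prop
  exact h.integrable_of_hasCompactSupport (HasCompactSupport.of_compactSpace _)

/-- The Ruelle operator as a linear map on continuous functions. -/
noncomputable def ruelleMap (μ : Measure M) [IsFiniteMeasure μ] (f : C(ℕ → M, ℝ)) :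
    C(ℕ → M, ℝ) →ₗ[ℝ] C(ℕ → M, ℝ) where
  toFun φ := ⟨ruelleOp μ f φ, continuous_ruelleOp μ f φ⟩
  map_add' φ ψ := by
    ext x
    simp only [ruelleOp, ContinuousMap.coe_mk, ContinuousMap.add_apply, mul_add]
    exact integral_add (integrable_ruelleOp μ f φ x) (integrable_ruelleOp μ f ψ x)
  map_smul' c φ := by
    ext x
    simp only [ruelleOp, ContinuousMap.coe_mk, ContinuousMap.smul_apply, smul_eq_mul,
      RingHom.id_apply]
    rw [← integral_const_mul]
    exact integral_congr_ae (Eventually.of_forall fun a => by ring)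

theorem ruelleMap_apply (μ : Measure M) [IsFiniteMeasure μ] (f φ : C(ℕ → M, ℝ)) (x : ℕ → M) :
    ruelleMap μ f φ x = ∫ a, Real.exp (f (cons a x)) * φ (cons a x) ∂μ := rfl

/-- As `σ (a x) = x`, the factor `φ ∘ σ` does not depend on the integration variable. -/
theorem ruelleMap_comp_shift_mul (μ : Measure M) [IsFiniteMeasure μ] (f φ ψ : C(ℕ → M, ℝ)) :
    ruelleMap μ f (φ.comp ⟨shift, continuous_shift⟩ * ψ) = φ * ruelleMap μ f ψ := by
  ext x
  simp only [ruelleMap_apply, ContinuousMap.mul_apply, ContinuousMap.comp_apply,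
    ContinuousMap.coe_mk, shift_cons]
  rw [← integral_const_mul]
  exact integral_congr_ae (Eventually.of_forall fun a => by ring)

theorem ruelleMap_pow_comp_shift_mul (μ : Measure M) [IsFiniteMeasure μ] (f φ ψ : C(ℕ → M, ℝ))
    (n : ℕ) : (ruelleMap μ f ^ n) (φ.comp ⟨shift^[n], continuous_shift.iterate n⟩ * ψ)
      = φ * (ruelleMap μ f ^ n) ψ := by
  induction n generalizing ψ with
  | zero => rfl
  | succ n ih =>
    have e : φ.comp ⟨shift^[n + 1], continuous_shift.iterate (n + 1)⟩
        = (φ.comp ⟨shift^[n], continuous_shift.iterate n⟩).comp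
          (⟨shift, continuous_shift⟩ : C(ℕ → M, ℕ → M)) := rfl
    rw [pow_succ, Module.End.mul_apply, Module.End.mul_apply, e, ruelleMap_comp_shift_mul, ih]

/-- Replacing `a x` by `a y` changes `exp f * φ` by a factor of at most `exp ((|c| + B) * 2 ^ (-α) *
ρ x y)`. This is uniform in `a`, so it survives integration. -/
theorem isLogContraction_ruelleMap (μ : Measure M) [IsProbabilityMeasure μ] {α : ℝ} (hα : 0 < α)
    (f : C(ℕ → M, ℝ)) {c : ℝ} (hf : ∀ x y, |f x - f y| ≤ c * gauge α x y) :
    IsLogContraction (gauge α) (Metric.diam (Set.univ : Set M) ^ α) ((1 / 2) ^ α)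
      (|c| * (1 / 2) ^ α) (ruelleMap μ f) where
  gauge_nonneg := gauge_nonneg α
  gauge_symm x y := by rw [gauge, seqDist_comm, gauge]
  gauge_le := gauge_le hα
  rate_nonneg := by positivity
  rate_lt_one := Real.rpow_lt_one (by norm_num) (by norm_num) hα
  error_nonneg := by positivity
  map_nonneg φ hφ := ContinuousMap.le_def.2 fun x =>
    integral_nonneg fun a => mul_nonneg (Real.exp_pos _).le (ContinuousMap.le_def.1 hφ _)
  map_logLip B φ hB hφ := by
    refine ⟨fun x => ?_, fun x y => ?_⟩
    · rw [ruelleMap_apply, integral_pos_iff_support_of_nonneg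
        (fun a => (mul_pos (Real.exp_pos _) (hφ.1 _)).le) (integrable_ruelleOp μ f φ x)]
      have : Function.support (fun a => Real.exp (f (cons a x)) * φ (cons a x)) = Set.univ :=
        Set.eq_univ_of_forall fun a => (mul_pos (Real.exp_pos _) (hφ.1 _)).ne'
      rw [this, measure_univ]
      exact one_pos
    · rw [ruelleMap_apply, ruelleMap_apply, ← integral_const_mul]
      refine integral_mono (integrable_ruelleOp μ f φ x)
        ((integrable_ruelleOp μ f φ y).const_mul _) fun a => ?_
      have h1 : f (cons a x) ≤ |c| * ((1 / 2) ^ α * gauge α x y) + f (cons a y) := by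
        have h2 := (le_abs_self _).trans (hf (cons a x) (cons a y))
        rw [gauge_cons] at h2
        have h3 := gauge_nonneg α x y
        have h4 : c * ((1 / 2) ^ α * gauge α x y) ≤ |c| * ((1 / 2) ^ α * gauge α x y) := by
          gcongr
          exact le_abs_self c
        linarith
      have h5 := hφ.2 (cons a x) (cons a y)
      rw [gauge_cons] at h5
      have h6 := hφ.1 (cons a x)
      calc Real.exp (f (cons a x)) * φ (cons a x)
          ≤ Real.exp (|c| * ((1 / 2) ^ α * gauge α x y) + f (cons a y)) *
            (Real.exp (B * ((1 / 2) ^ α * gauge α x y)) * φ (cons a y)) := by gcongr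
        _ = _ := by
          rw [Real.exp_add, show ((1 / 2) ^ α * B + |c| * (1 / 2) ^ α) * gauge α x y
            = |c| * ((1 / 2) ^ α * gauge α x y) + B * ((1 / 2) ^ α * gauge α x y) by ring,
            Real.exp_add]
          ring

end Operator

/-! ### Decay of correlations -/

section

variable {M : Type*} [MetricSpace M] [CompactSpace M] [MeasurableSpace M] [BorelSpace M]

theorem integrable_continuousMap {X : Type*} [TopologicalSpace X] [CompactSpace X]
    [MeasurableSpace X] [OpensMeasurableSpace X] (ν : Measure X) [IsFiniteMeasure ν] (φ : C(X, ℝ)) :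
    Integrable φ ν :=
  φ.continuous.integrable_of_hasCompactSupport (HasCompactSupport.of_compactSpace _)

/-- Integration against a finite measure, as a linear functional on continuous functions. -/
noncomputable def integralFunctional {X : Type*} [TopologicalSpace X] [CompactSpace X]
    [MeasurableSpace X] [OpensMeasurableSpace X] (ν : Measure X) [IsFiniteMeasure ν] :
    C(X, ℝ) →ₗ[ℝ] ℝ where
  toFun φ := ∫ x, φ x ∂ν
  map_add' φ ψ := integral_add (integrable_continuousMap ν φ) (integrable_continuousMap ν ψ)
  map_smul' c φ := integral_const_mul c φ

theorem integral_eqMeasure (ν : Measure (ℕ → M)) {h : (ℕ → M) → ℝ} (hc : Continuous h)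
    (h0 : ∀ x, 0 < h x) (g : (ℕ → M) → ℝ) :
    ∫ x, g x ∂(eqMeasure h ν) = ∫ x, g x * h x ∂ν := by
  rw [eqMeasure, integral_withDensity_eq_integral_toReal_smul
    hc.measurable.ennreal_ofReal (Eventually.of_forall fun x => ENNReal.ofReal_lt_top)]
  refine integral_congr_ae (Eventually.of_forall fun x => ?_)
  simp only [ENNReal.toReal_ofReal (h0 x).le, smul_eq_mul]
  ring

/-- Exponential decay of correlations for the equilibrium measure of spectral data. -/
theorem correlation_decay {μ : Measure M} [IsProbabilityMeasure μ] {α A lam τ : ℝ}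
    {f h : C(ℕ → M, ℝ)} {Λ : C(ℕ → M, ℝ) →ₗ[ℝ] ℝ}
    (hS : IsSpectralData (gauge α) (ruelleMap μ f) A lam h Λ τ) (hh : Lip (gauge α) h)
    {ν : Measure (ℕ → M)} [IsProbabilityMeasure ν] (hν : ∀ φ : C(ℕ → M, ℝ), ∫ x, φ x ∂ν = Λ φ)
    (φ : C(ℕ → M, ℝ)) {ψ : C(ℕ → M, ℝ)} (hψ : Lip (gauge α) ψ) :
    ∃ K : ℝ, 0 < K ∧ ∀ n : ℕ, |correlation (eqMeasure h ν) φ ψ n| ≤ K * τ ^ n := by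
  obtain ⟨K, hK0, hK⟩ := hS.abs_div_pow_le (hψ.mul hh)
  refine ⟨‖φ‖ * K + 1, by positivity, fun n => ?_⟩
  have hτ := hS.rate_pos
  have h0 : 0 < lam ^ n := pow_pos hS.lam_pos n
  set L := ruelleMap μ f
  -- Duality inserts `lam⁻ⁿ L ^ n` under `Λ`, and `L ^ n` then strips the shift from `φ`. What
  -- remains is the convergence of `lam⁻ⁿ L ^ n (ψ * h)`; only the sup norm of `φ` enters.
  have e1 : ∫ x, φ (shift^[n] x) * ψ x ∂(eqMeasure h ν)
      = Λ ((lam ^ n)⁻¹ • (φ * (L ^ n) (ψ * h))) := by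
    rw [integral_eqMeasure ν h.continuous hS.logLip.1, map_smul,
      ← ruelleMap_pow_comp_shift_mul μ f φ (ψ * h) n, dual_pow_eq hS.dual_eq, smul_eq_mul,
      inv_mul_cancel_left₀ h0.ne', ← hν]
    simp only [ContinuousMap.mul_apply, ContinuousMap.comp_apply, ContinuousMap.coe_mk, mul_assoc]
  have e2 : ∀ χ : C(ℕ → M, ℝ), ∫ x, χ x ∂(eqMeasure h ν) = Λ (χ * h) := fun χ => by
    rw [integral_eqMeasure ν h.continuous hS.logLip.1, ← hν]
    rfl
  have e3 : correlation (eqMeasure h ν) φ ψ n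
      = Λ ((lam ^ n)⁻¹ • (φ * (L ^ n) (ψ * h)) - Λ (ψ * h) • (φ * h)) := by
    rw [correlation, e1, e2, e2, map_sub, map_smul _ (Λ (ψ * h)), smul_eq_mul, mul_comm (Λ (φ * h))]
  have hb : ∀ x, |((lam ^ n)⁻¹ • (φ * (L ^ n) (ψ * h)) - Λ (ψ * h) • (φ * h)) x|
      ≤ ‖φ‖ * K * τ ^ n := by
    intro x
    have e4 : ((lam ^ n)⁻¹ • (φ * (L ^ n) (ψ * h)) - Λ (ψ * h) • (φ * h)) x
        = φ x * ((L ^ n) (ψ * h) x / lam ^ n - Λ (ψ * h) * h x) := by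
      simp only [ContinuousMap.sub_apply, ContinuousMap.smul_apply, ContinuousMap.mul_apply,
        smul_eq_mul]
      ring
    rw [e4, abs_mul, mul_assoc]
    exact mul_le_mul (φ.norm_coe_le_norm x) (hK n x) (abs_nonneg _) (norm_nonneg _)
  rw [e3]
  refine (abs_le.2 ⟨le_functional hS.nonneg hS.map_one fun x => (abs_le.1 (hb x)).1,
    functional_le hS.nonneg hS.map_one fun x => (abs_le.1 (hb x)).2⟩).trans ?_
  exact mul_le_mul_of_nonneg_right (by linarith) (by positivity)

end

end RuelleShift

open RuelleShift

theorem proposition2p3 {M : Type*} [MetricSpace M] [CompactSpace M] [MeasurableSpace M]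
    [BorelSpace M] (μ : MeasureTheory.Measure M) [MeasureTheory.IsProbabilityMeasure μ]
    [μ.IsOpenPosMeasure] (α : ℝ) (hα0 : 0 < α) (hα1 : α < 1)
    (f : (ℕ → M) → ℝ) (hf : RuelleShift.IsHolder α f) :
    ∃ (lam : ℝ) (h : (ℕ → M) → ℝ) (ν : MeasureTheory.Measure (ℕ → M)),
      RuelleShift.IsEigendata α μ f lam h ν ∧
      (∀ (lam' : ℝ) (h' : (ℕ → M) → ℝ) (ν' : MeasureTheory.Measure (ℕ → M)),
        RuelleShift.IsEigendata α μ f lam' h' ν' → lam' = lam ∧ h' = h ∧ ν' = ν) ∧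
      ∀ φ ψ : (ℕ → M) → ℝ, RuelleShift.IsHolder α φ → RuelleShift.IsHolder α ψ →
        ∃ K τ : ℝ, 0 < K ∧ 0 < τ ∧ τ < 1 ∧
          ∀ n : ℕ, |RuelleShift.correlation (RuelleShift.eqMeasure h ν) φ ψ n| ≤ K * τ ^ n := by
  have : Nonempty M := nonempty_of_isProbabilityMeasure μ
  let F : C(ℕ → M, ℝ) := ⟨f, hf.continuous hα0⟩
  obtain ⟨c, hc⟩ := hf
  have hL := isLogContraction_ruelleMap μ hα0 F (c := c) hc
  have hdense := dense_lip (M := M) hα0 hα1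
  obtain ⟨lam, h, Λ, τ, hS⟩ := hL.exists_spectralData hdense
  obtain ⟨ν, hprob, hν⟩ := exists_measure_of_positive hS.nonneg hS.map_one
  have hh : Lip (gauge α) h :=
    hS.logLip.lip hL.gauge_nonneg hL.gauge_symm hL.gauge_le hL.fixed_nonneg
  refine ⟨lam, h, ν, ⟨hS.lam_pos, hh, hS.logLip.1, fun x => ?_, hprob, fun φ hφ => ?_, ?_⟩,
    fun lam' h' ν' H => ?_, fun φ ψ hφ hψ => ?_⟩
  · exact congrArg (fun g : C(ℕ → M, ℝ) => g x) hS.map_eq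
  · exact (hν (ruelleMap μ F ⟨φ, hφ⟩)).trans
      ((hS.dual_eq _).trans (congrArg (lam * ·) (hν ⟨φ, hφ⟩).symm))
  · rw [hν, hS.normalized]
  · have := H.prob
    let H' : C(ℕ → M, ℝ) := ⟨h', H.holder.continuous hα0⟩
    obtain ⟨rfl, hH'⟩ := hS.eigenfunction_unique (h' := H') H.holder H.h_pos
      (ContinuousMap.ext H.eigenfunction)
    have hΛ : ∀ φ, integralFunctional ν' φ = Λ φ :=
      hS.functional_unique hdense (fun φ hφ => integral_nonneg (ContinuousMap.le_def.1 hφ))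
        (by simp [integralFunctional]) fun φ => H.eigenmeasure φ φ.continuous
    -- The normalization of `h'` fixes the scalar left free by simplicity of the eigenvalue.
    have hone : Λ H' = 1 := (hΛ H').symm.trans H.normalized
    rw [hone, one_smul] at hH'
    refine ⟨rfl, congrArg (fun g : C(ℕ → M, ℝ) => (g : (ℕ → M) → ℝ)) hH', ?_⟩
    exact ext_of_forall_integral_eq_of_IsFiniteMeasure fun g =>
      (hΛ g.toContinuousMap).trans (hν g.toContinuousMap).symm
  · obtain ⟨K, hK0, hK⟩ := correlation_decay hS hh hν ⟨φ, hφ.continuous hα0⟩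
      (ψ := ⟨ψ, hψ.continuous hα0⟩) hψ
    exact ⟨K, τ, hK0, hS.rate_pos, hS.rate_lt_one, hK⟩
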